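/- Let $(X_p)_{p \text{ prime}}$ be independent random variables, each uniformly distributed on the unit circle of $\mathbb{C}$, and extend them to a random completely multiplicative function $(X_n)_{n\ge 1}$ by $X_n = \prod_{p \mid n} X_p^{v_p(n)}$ (so $X_1 = 1$ and $X_{mn}=X_mX_n$ for all $m,n\ge 1$). For an integer $N\ge 1$, let $\mathcal{N}(N)$ (resp. $\mathcal{N}_{=}(N)$) be the number of quadruples of integers $(a,b,c,d)$ such that $$a(a+1)d(d+1) = b(b+1)c(c+1)$$ and $0<a<b<c<d\le N$ (resp. $0<a<b=c<d\le N$). Then, for every $N \ge 1$, $$\mathbb{E}\left[\left|\sum_{n=1}^N X_nX_{n+1}\right|^4\right] = 2N^2 - N + 8\,\mathcal{N}(N) + 4\,\mathcal{N}_{=}(N).$$ Moreover, for every $\epsilon>0$ there exists $C_\epsilon>0$, independent of $N$, such that for all $N\ge 8$, $$\frac N2 \le 8\,\mathcal{N}(N)+4\,\mathcal{N}_{=}(N) \le C_\epsilon N^{3/2+\epsilon}.$$ Hence, for every $\epsilon>0$, $$\mathbb{E}\left[\left|\sum_{n=1}^N X_nX_{n+1}\right|^4\right] = 2N^2 + O_\epsilon\left(N^{3/2+\epsilon}\right)$$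 for $N \ge 1$, where the implied constant depends only on $\epsilon$. -/

import Mathlib

open MeasureTheory ProbabilityTheory

universe u

/-- The uniform probability measure on the unit circle of `ℂ`: the law of `exp (2πi t)` for `t`
uniform on `[0, 1]`. -/
noncomputable def uniformCircle : Measure ℂ :=
  (volume.restrict (Set.Icc (0 : ℝ) 1)).map
    (fun t : ℝ => Complex.exp (2 * Real.pi * t * Complex.I))

/-- The complex random variables `Y p`, indexed by the primes, are independent and all uniform on
the unit circle. -/
structure IsIIDUniformOnCircle {Ω : Type u} [MeasurableSpace Ω] (P : Measure Ω)
    (Y : Nat.Primes → Ω → ℂ) : Prop where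
  measurable : ∀ p, Measurable (Y p)
  law : ∀ p, P.map (Y p) = uniformCircle
  indep : iIndepFun Y P

/-- The completely multiplicative function on the positive integers with prescribed values at the
primes: `n ↦ ∏_{p ∣ n} (y p) ^ (v_p n)`. -/
noncomputable def complMultExt (y : Nat.Primes → ℂ) (n : ℕ) : ℂ :=
  ∏ p : n.primeFactors, y ⟨p, Nat.prime_of_mem_primeFactors p.2⟩ ^ n.factorization p

theorem complMultExt_eq_prod (y : Nat.Primes → ℂ) (n : ℕ) :
    complMultExt y n =
      n.factorization.prod fun p k => (if h : p.Prime then y ⟨p, h⟩ else 1) ^ k := by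
  unfold complMultExt Finsupp.prod
  rw [Nat.support_factorization, ← Finset.prod_coe_sort n.primeFactors]
  refine Fintype.prod_congr _ _ fun p => ?_
  have h : (p : ℕ).Prime := Nat.prime_of_mem_primeFactors p.2
  have h' : (if h : (p : ℕ).Prime then y ⟨p, h⟩ else 1) = y ⟨p, h⟩ := dif_pos h
  beta_reduce
  rw [h']

theorem complMultExt_one (y : Nat.Primes → ℂ) : complMultExt y 1 = 1 := by
  simp [complMultExt_eq_prod]

theorem complMultExt_prime (y : Nat.Primes → ℂ) (p : Nat.Primes) :
    complMultExt y p = y p := by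
  rw [complMultExt_eq_prod, p.2.factorization, Finsupp.prod_single_index (by simp),
    dif_pos p.2, pow_one]
  rfl

theorem complMultExt_mul (y : Nat.Primes → ℂ) {m n : ℕ} (hm : 0 < m) (hn : 0 < n) :
    complMultExt y (m * n) = complMultExt y m * complMultExt y n := by
  simp only [complMultExt_eq_prod]
  rw [Nat.factorization_mul hm.ne' hn.ne',
    Finsupp.prod_add_index' (fun _ => pow_zero _) (fun _ _ _ => pow_add _ _ _)]

/-- `E[|∑_{n=1}^N X_n X_{n+1}|^4]`, where `X` is the random completely multiplicative function with
values `Y p` at the primes. -/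
noncomputable def fourthMoment {Ω : Type u} [MeasurableSpace Ω] (P : Measure Ω)
    (Y : Nat.Primes → Ω → ℂ) (N : ℕ) : ℝ :=
  ∫ ω, ‖∑ n ∈ Finset.Icc 1 N,
    complMultExt (fun p => Y p ω) n * complMultExt (fun p => Y p ω) (n + 1)‖ ^ 4 ∂P

/-- The number of integer quadruples `(a, b, c, d)` with `0 < a < b < c < d ≤ N` and
`a(a+1)d(d+1) = b(b+1)c(c+1)`. -/
noncomputable def numSol (N : ℕ) : ℕ :=
  Set.ncard {q : ℕ × ℕ × ℕ × ℕ | ∃ a b c d : ℕ, q = (a, b, c, d) ∧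
    0 < a ∧ a < b ∧ b < c ∧ c < d ∧ d ≤ N ∧
    a * (a + 1) * d * (d + 1) = b * (b + 1) * c * (c + 1)}

/-- The number of integer quadruples `(a, b, c, d)` with `0 < a < b = c < d ≤ N` and
`a(a+1)d(d+1) = b(b+1)c(c+1)`. -/
noncomputable def numSolEq (N : ℕ) : ℕ :=
  Set.ncard {q : ℕ × ℕ × ℕ × ℕ | ∃ a b c d : ℕ, q = (a, b, c, d) ∧
    0 < a ∧ a < b ∧ b = c ∧ c < d ∧ d ≤ N ∧
    a * (a + 1) * d * (d + 1) = b * (b + 1) * c * (c + 1)}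

/-!
Write `f(n) = n(n+1)`, so that `X_n X_{n+1} = X_{f(n)}`.

**The fourth moment.** Independence over primes makes the variables `X_m` orthonormal in `L²`
(`IsIIDUniformOnCircle.integral_complMultExt_mul_conj`). Expanding the fourth power, the moment is
the number of `(a, d, b, c) ∈ [1, N]⁴` with `f(a) f(d) = f(b) f(c)`. The trivial solutions, with
`{a, d} = {b, c}`, number `2N² - N`. As `f` is strictly increasing, in any other solution one of
the pairs `{a, d}`, `{b, c}` lies strictly inside the other, and the symmetries of the equation
bring it to the form `a < b ≤ c < d`: eight solutions for each one with `b < c`, four for each one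
with `b = c` (`sum_solutions`).

**The lower bound** comes from the identity `f(n) f(6n+2) = f(2n+1) f(3n)`.

**The upper bound.** For a solution with `a < b ≤ c < d`, put `x_a = 2a + 1` and so on, and let
`h = x_a x_d - x_b x_c`. Then `h > 0` and `h x_a < x_d` (`defect_pos`, `defect_mul_lt`), hence
`a h ≤ N`, and eliminating `x_b x_c` turns the equation into
`(x_d - (h + 1) x_a)² - (x_c - x_b)² = h (h + 2) (x_a² - 1)`.
So `a`, `h` and one divisor of the nonzero number `h (h + 2) · 4 f(a)` determine the solution
(`eq_of_defect_eq_of_smallFactor_eq`). By the divisor bound `card_divisors_le_rpow` there are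
`O_ε(N^{1+ε})` pairs `(a, h)` and `O_ε(N^ε)` divisors for each. The resulting bound `O_ε(N^{1+ε})`
is stronger than the one required.
-/

/-! ### The divisor bound -/

/-- At a single prime the divisor bound holds with a constant independent of the prime. -/
theorem add_one_le_mul_pow_rpow {ε : ℝ} (hε : 0 < ε) {p : ℕ} (hp : 2 ≤ p) (v : ℕ) :
    (v : ℝ) + 1 ≤ (1 + 1 / (ε * Real.log 2)) * ((p : ℝ) ^ v) ^ ε := by
  have hl : 0 < ε * Real.log 2 := mul_pos hε (Real.log_pos one_lt_two)
  have h1 : v * (ε * Real.log 2) + 1 ≤ ((p : ℝ) ^ v) ^ ε := by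
    have h2 : ((2 : ℝ) ^ v) ^ ε = Real.exp (v * (ε * Real.log 2)) := by
      rw [Real.rpow_def_of_pos (by positivity), Real.log_pow]
      ring_nf
    calc _ ≤ Real.exp (v * (ε * Real.log 2)) := Real.add_one_le_exp _
      _ = ((2 : ℝ) ^ v) ^ ε := h2.symm
      _ ≤ _ := by
        have : (2 : ℝ) ≤ p := by exact_mod_cast hp
        gcongr
  calc (v : ℝ) + 1 ≤ (1 + 1 / (ε * Real.log 2)) * (v * (ε * Real.log 2) + 1) := by
        have : (1 + 1 / (ε * Real.log 2)) * (v * (ε * Real.log 2) + 1)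
            = v + 1 + (v * (ε * Real.log 2) + 1 / (ε * Real.log 2)) := by
          field_simp
          ring
        rw [this]
        have : 0 ≤ v * (ε * Real.log 2) + 1 / (ε * Real.log 2) := by positivity
        linarith
    _ ≤ _ := by gcongr

/-- At primes `p ≥ 2 ^ (1 / ε)` the constant in the divisor bound can be taken to be `1`. -/
theorem add_one_le_pow_rpow_of_large {ε : ℝ} {p : ℕ} (hp : 2 ≤ (p : ℝ) ^ ε) (v : ℕ) :
    (v : ℝ) + 1 ≤ ((p : ℝ) ^ v) ^ ε := by
  calc (v : ℝ) + 1 ≤ 2 ^ v := by exact_mod_cast v.lt_two_pow_self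
    _ ≤ ((p : ℝ) ^ ε) ^ v := by gcongr
    _ = _ := by
      rw [← Real.rpow_natCast, ← Real.rpow_natCast, ← Real.rpow_mul (by positivity),
        ← Real.rpow_mul (by positivity), mul_comm]

/-- The divisor bound: the number of divisors of `n` is `O_ε (n ^ ε)` for every `ε > 0`. -/
theorem card_divisors_le_rpow {ε : ℝ} (hε : 0 < ε) :
    ∃ C : ℝ, 0 < C ∧ ∀ n : ℕ, n ≠ 0 → (n.divisors.card : ℝ) ≤ C * (n : ℝ) ^ ε := by
  set K : ℝ := 1 + 1 / (ε * Real.log 2)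
  have hK : 1 ≤ K := by
    have : 0 ≤ 1 / (ε * Real.log 2) := by positivity
    simp only [K]; linarith
  obtain ⟨B, hB⟩ := exists_nat_ge ((2 : ℝ) ^ (1 / ε))
  -- only the primes below `B`, at most `B` in number, contribute a factor `K`
  refine ⟨K ^ B, by positivity, fun n hn => ?_⟩
  have hlarge : ∀ p : ℕ, B ≤ p → 2 ≤ (p : ℝ) ^ ε := fun p hp => by
    calc (2 : ℝ) = ((2 : ℝ) ^ (1 / ε)) ^ ε := by
          rw [← Real.rpow_mul (by norm_num), one_div_mul_cancel hε.ne', Real.rpow_one]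
      _ ≤ (p : ℝ) ^ ε := by
          have : (B : ℝ) ≤ p := by exact_mod_cast hp
          exact Real.rpow_le_rpow (by positivity) (hB.trans this) hε.le
  have hloc : ∀ p ∈ n.primeFactors, ((n.factorization p : ℝ) + 1) ≤
      (if p < B then K else 1) * ((p : ℝ) ^ n.factorization p) ^ ε := fun p hp => by
    split_ifs with h
    · exact add_one_le_mul_pow_rpow hε (Nat.prime_of_mem_primeFactors hp).two_le _
    · rw [one_mul]
      exact add_one_le_pow_rpow_of_large (hlarge p (not_lt.1 h)) _
  have hprod : ∏ p ∈ n.primeFactors, ((p : ℝ) ^ n.factorization p) ^ ε = (n : ℝ) ^ ε := by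
    rw [Real.finsetProd_rpow _ _ fun i _ => by positivity]
    congr 1
    exact_mod_cast Nat.prod_factorization_pow_eq_self hn
  have hconst : ∏ p ∈ n.primeFactors, (if p < B then K else 1) ≤ K ^ B := by
    rw [Finset.prod_ite, Finset.prod_const, Finset.prod_const_one, mul_one]
    refine pow_le_pow_right₀ hK ?_
    calc _ ≤ (Finset.range B).card := Finset.card_le_card fun p hp => by
          simpa using (Finset.mem_filter.1 hp).2
      _ = B := Finset.card_range B
  rw [Nat.card_divisors hn]
  push_cast
  calc _ ≤ ∏ p ∈ n.primeFactors,
        ((if p < B then K else 1) * ((p : ℝ) ^ n.factorization p) ^ ε) :=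
        Finset.prod_le_prod (fun _ _ => by positivity) hloc
    _ ≤ K ^ B * (n : ℝ) ^ ε := by
        rw [Finset.prod_mul_distrib, hprod]
        gcongr

/-! ### Moments of the random multiplicative function -/

open ComplexConjugate in
theorem integral_uniformCircle_pow_mul_conj_pow (i j : ℕ) :
    ∫ z, z ^ i * conj z ^ j ∂uniformCircle = if i = j then 1 else 0 := by
  unfold uniformCircle
  rw [integral_map (by fun_prop) (by fun_prop)]
  have hint : ∀ t : ℝ, Complex.exp (2 * Real.pi * t * Complex.I) ^ i *
      conj (Complex.exp (2 * Real.pi * t * Complex.I)) ^ j =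
      Complex.exp ((2 * Real.pi * Complex.I * ((i : ℂ) - j)) * t) := fun t => by
    rw [← Complex.exp_conj, ← Complex.exp_nat_mul, ← Complex.exp_nat_mul, ← Complex.exp_add]
    congr 1
    simp only [map_mul, Complex.conj_I, Complex.conj_ofReal, map_ofNat]
    ring
  simp_rw [hint]
  rw [integral_Icc_eq_integral_Ioc, ← intervalIntegral.integral_of_le zero_le_one]
  split_ifs with h
  · simp [h]
  · have hij : (i : ℂ) - j ≠ 0 := sub_ne_zero.2 (by exact_mod_cast h)
    have hc : 2 * Real.pi * Complex.I * ((i : ℂ) - j) ≠ 0 :=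
      mul_ne_zero Complex.two_pi_I_ne_zero hij
    rw [integral_exp_mul_complex hc]
    have : Complex.exp (2 * Real.pi * Complex.I * ((i : ℂ) - j)) = 1 :=
      Complex.exp_eq_one_iff.2 ⟨i - j, by push_cast; ring⟩
    simp [this]

theorem ae_norm_eq_one_uniformCircle : ∀ᵐ z ∂uniformCircle, ‖z‖ = 1 := by
  unfold uniformCircle
  rw [ae_map_iff (by fun_prop) (measurableSet_eq_fun (by fun_prop) (by fun_prop))]
  refine Filter.Eventually.of_forall fun t => ?_
  rw [show (2 * Real.pi * t * Complex.I : ℂ) = ((2 * Real.pi * t : ℝ) : ℂ) * Complex.I by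
    push_cast; ring]
  exact Complex.norm_exp_ofReal_mul_I _

/-- The product defining `complMultExt y m` may be taken over the prime factors of any nonzero
multiple of `m`. -/
theorem complMultExt_eq_prod_of_dvd (y : Nat.Primes → ℂ) {m k : ℕ} (hk : k ≠ 0) (h : m ∣ k) :
    complMultExt y m = ∏ p : k.primeFactors,
      y ⟨p, Nat.prime_of_mem_primeFactors p.2⟩ ^ m.factorization p := by
  rw [complMultExt_eq_prod, Finsupp.prod_of_support_subset _
    (s := k.primeFactors) (by simpa using Nat.primeFactors_mono h hk) _ (by simp),
    ← Finset.prod_coe_sort k.primeFactors]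
  refine Fintype.prod_congr _ _ fun p => ?_
  rw [dif_pos (Nat.prime_of_mem_primeFactors p.2)]

section Moments

open ComplexConjugate

variable {Ω : Type u} [MeasurableSpace Ω] {P : Measure Ω} {Y : Nat.Primes → Ω → ℂ}

theorem IsIIDUniformOnCircle.ae_norm_eq_one (hY : IsIIDUniformOnCircle P Y) :
    ∀ᵐ ω ∂P, ∀ p, ‖Y p ω‖ = 1 := by
  refine ae_all_iff.2 fun p => ?_
  have h := ae_norm_eq_one_uniformCircle
  rw [← hY.law p] at h
  exact ae_of_ae_map (hY.measurable p).aemeasurable h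

theorem IsIIDUniformOnCircle.ae_norm_complMultExt (hY : IsIIDUniformOnCircle P Y) :
    ∀ᵐ ω ∂P, ∀ n, ‖complMultExt (fun p => Y p ω) n‖ = 1 := by
  filter_upwards [hY.ae_norm_eq_one] with ω hω n
  rw [complMultExt, norm_prod]
  exact Finset.prod_eq_one fun p _ => 
    (norm_pow _ _).trans ((congrArg (· ^ _) (hω _)).trans (one_pow _))

theorem IsIIDUniformOnCircle.measurable_complMultExt (hY : IsIIDUniformOnCircle P Y) (n : ℕ) :
    Measurable fun ω => complMultExt (fun p => Y p ω) n :=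
  Finset.measurable_prod _ fun _ _ => (hY.measurable _).pow_const _

/-- Integrable because bounded: `‖X_n‖ = 1` holds almost surely, though not everywhere. -/
theorem IsIIDUniformOnCircle.integrable_complMultExt_mul_conj [IsProbabilityMeasure P]
    (hY : IsIIDUniformOnCircle P Y) (m n : ℕ) :
    Integrable (fun ω => complMultExt (fun p => Y p ω) m *
      conj (complMultExt (fun p => Y p ω) n)) P := by
  refine Integrable.of_bound (C := 1) ?_ ?_
  · exact ((hY.measurable_complMultExt m).mul
      (Complex.continuous_conj.measurable.comp (hY.measurable_complMultExt n))).aestronglyMeasurable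
  · filter_upwards [hY.ae_norm_complMultExt] with ω hω
    simp [hω]

/-- Orthogonality: the variables `X_m` form an orthonormal system in `L²`. By independence, the
correlation factors over primes, and the factor at `p` is `1` or `0` according to whether `p` has
the same exponent in `m` and `n`. -/
theorem IsIIDUniformOnCircle.integral_complMultExt_mul_conj
    (hY : IsIIDUniformOnCircle P Y) {m n : ℕ} (hm : m ≠ 0) (hn : n ≠ 0) :
    ∫ ω, complMultExt (fun p => Y p ω) m * conj (complMultExt (fun p => Y p ω) n) ∂P =
      if m = n then 1 else 0 := by
  have hmn : m * n ≠ 0 := mul_ne_zero hm hn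
  let g : (m * n).primeFactors → Nat.Primes :=
    fun p => ⟨p, Nat.prime_of_mem_primeFactors p.2⟩
  have hg : g.Injective := fun p q h => Subtype.ext (congrArg (fun r : Nat.Primes => (r : ℕ)) h)
  have hprod : ∀ ω, complMultExt (fun p => Y p ω) m * conj (complMultExt (fun p => Y p ω) n) =
      ∏ p : (m * n).primeFactors,
        (fun z : ℂ => z ^ m.factorization p * conj z ^ n.factorization p) (Y (g p) ω) := by
    intro ω
    rw [complMultExt_eq_prod_of_dvd _ hmn (Dvd.intro _ rfl),
      complMultExt_eq_prod_of_dvd _ hmn (Dvd.intro_left _ rfl), map_prod,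
      ← Finset.prod_mul_distrib]
    simp [g]
  have hfac : ∀ p : (m * n).primeFactors,
      ∫ ω, (fun z : ℂ => z ^ m.factorization p * conj z ^ n.factorization p) (Y (g p) ω) ∂P =
        if m.factorization p = n.factorization p then 1 else 0 := fun p => by
    rw [← integral_uniformCircle_pow_mul_conj_pow, ← hY.law (g p),
      integral_map (hY.measurable _).aemeasurable (by fun_prop)]
  simp_rw [hprod]
  rw [(hY.indep.precomp hg).integral_fun_prod_comp
    (f := fun (p : (m * n).primeFactors) (z : ℂ) =>
      z ^ m.factorization p * conj z ^ n.factorization p)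
    (fun p => (hY.measurable _).aemeasurable) (fun p => by fun_prop), Fintype.prod_congr _ _ hfac]
  split_ifs with h
  · simp [h]
  · by_contra hne
    refine h (Nat.eq_of_factorization_eq hm hn fun p => ?_)
    by_cases hp : p ∈ (m * n).primeFactors
    · by_contra hpe
      exact hne (Finset.prod_eq_zero (Finset.mem_univ ⟨p, hp⟩) (if_neg hpe))
    · rw [Nat.primeFactors_mul hm hn, Finset.notMem_union] at hp
      rw [Finsupp.notMem_support_iff.1 (by simpa using hp.1),
        Finsupp.notMem_support_iff.1 (by simpa using hp.2)]

/-- The fourth moment counts the solutions of `a(a+1)d(d+1) = b(b+1)c(c+1)` in `[1, N]⁴`. -/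
theorem IsIIDUniformOnCircle.fourthMoment_eq_sum [IsProbabilityMeasure P]
    (hY : IsIIDUniformOnCircle P Y) (N : ℕ) :
    fourthMoment P Y N = ∑ a ∈ Finset.Icc 1 N, ∑ d ∈ Finset.Icc 1 N, ∑ b ∈ Finset.Icc 1 N,
      ∑ c ∈ Finset.Icc 1 N,
        if a * (a + 1) * (d * (d + 1)) = b * (b + 1) * (c * (c + 1)) then (1 : ℝ) else 0 := by
  have hexp : ∀ ω, ((‖∑ n ∈ Finset.Icc 1 N, complMultExt (fun p => Y p ω) n *
      complMultExt (fun p => Y p ω) (n + 1)‖ ^ 4 : ℝ) : ℂ) =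
      ∑ a ∈ Finset.Icc 1 N, ∑ d ∈ Finset.Icc 1 N, ∑ b ∈ Finset.Icc 1 N, ∑ c ∈ Finset.Icc 1 N,
        complMultExt (fun p => Y p ω) (a * (a + 1) * (d * (d + 1))) *
          conj (complMultExt (fun p => Y p ω) (b * (b + 1) * (c * (c + 1)))) := by
    intro ω
    set S := ∑ n ∈ Finset.Icc 1 N, complMultExt (fun p => Y p ω) n *
      complMultExt (fun p => Y p ω) (n + 1) with hS
    have h4 : ((‖S‖ ^ 4 : ℝ) : ℂ) = (S * S) * (conj S * conj S) := by
      have := Complex.mul_conj' S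
      push_cast
      linear_combination (-(‖S‖ : ℂ) ^ 2 - S * conj S) * this
    rw [h4, hS, map_sum]
    rw [Finset.sum_mul_sum, Finset.sum_mul_sum, Finset.sum_mul]
    refine Finset.sum_congr rfl fun a ha => ?_
    rw [Finset.sum_mul]
    refine Finset.sum_congr rfl fun d hd => ?_
    rw [Finset.mul_sum]
    simp only [Finset.mul_sum]
    refine Finset.sum_congr rfl fun b hb => Finset.sum_congr rfl fun c hc => ?_
    have ha := (Finset.mem_Icc.1 ha).1
    have hb := (Finset.mem_Icc.1 hb).1
    have hc := (Finset.mem_Icc.1 hc).1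
    have hd := (Finset.mem_Icc.1 hd).1
    rw [complMultExt_mul _ (by positivity) (by positivity),
      complMultExt_mul _ (by positivity) (by positivity),
      complMultExt_mul _ (by positivity) (by positivity),
      complMultExt_mul _ (by positivity) (by positivity),
      complMultExt_mul _ (by positivity) (by positivity),
      complMultExt_mul _ (by positivity) (by positivity)]
    simp only [map_mul]
  have hI := fun m n : ℕ => hY.integrable_complMultExt_mul_conj m n
  rw [← Complex.ofReal_inj]
  unfold fourthMoment
  rw [← integral_complex_ofReal]
  simp_rw [hexp]
  push_cast
  rw [integral_finsetSum _ fun a _ => integrable_finsetSum _ fun d _ => integrable_finsetSum _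
    fun b _ => integrable_finsetSum _ fun c _ => hI _ _]
  refine Finset.sum_congr rfl fun a ha => ?_
  rw [integral_finsetSum _ fun d _ => integrable_finsetSum _
    fun b _ => integrable_finsetSum _ fun c _ => hI _ _]
  refine Finset.sum_congr rfl fun d hd => ?_
  rw [integral_finsetSum _ fun b _ => integrable_finsetSum _ fun c _ => hI _ _]
  refine Finset.sum_congr rfl fun b hb => ?_
  rw [integral_finsetSum _ fun c _ => hI _ _]
  refine Finset.sum_congr rfl fun c hc => ?_
  have ha := (Finset.mem_Icc.1 ha).1
  have hb := (Finset.mem_Icc.1 hb).1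
  have hc := (Finset.mem_Icc.1 hc).1
  have hd := (Finset.mem_Icc.1 hd).1
  rw [hY.integral_complMultExt_mul_conj (by positivity) (by positivity)]
  split_ifs <;> simp

end Moments

/-! ### Counting solutions up to symmetry -/

/-- The indicator of the solutions with `a < b`, `R b c` and `c < d`; the relation `R` is `<` for
the solutions counted by `numSol` and `=` for those counted by `numSolEq`. -/
def orderedInd (R : ℕ → ℕ → Prop) [DecidableRel R] (a d b c : ℕ) : ℝ :=
  if a < b ∧ R b c ∧ c < d ∧ a * (a + 1) * (d * (d + 1)) = b * (b + 1) * (c * (c + 1))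
  then 1 else 0

theorem ncard_eq_sum_orderedInd (R : ℕ → ℕ → Prop) [DecidableRel R]
    (hR : ∀ b c, R b c → b ≤ c) (N : ℕ) :
    (Set.ncard {q : ℕ × ℕ × ℕ × ℕ | ∃ a b c d : ℕ, q = (a, b, c, d) ∧
      0 < a ∧ a < b ∧ R b c ∧ c < d ∧ d ≤ N ∧
      a * (a + 1) * d * (d + 1) = b * (b + 1) * c * (c + 1)} : ℝ) =
    ∑ a ∈ Finset.Icc 1 N, ∑ d ∈ Finset.Icc 1 N, ∑ b ∈ Finset.Icc 1 N, ∑ c ∈ Finset.Icc 1 N,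
      orderedInd R a d b c := by
  have hset : {q : ℕ × ℕ × ℕ × ℕ | ∃ a b c d : ℕ, q = (a, b, c, d) ∧
      0 < a ∧ a < b ∧ R b c ∧ c < d ∧ d ≤ N ∧
      a * (a + 1) * d * (d + 1) = b * (b + 1) * c * (c + 1)} =
      ((Finset.Icc 1 N ×ˢ Finset.Icc 1 N ×ˢ Finset.Icc 1 N ×ˢ Finset.Icc 1 N).filter fun q =>
        q.1 < q.2.1 ∧ R q.2.1 q.2.2.1 ∧ q.2.2.1 < q.2.2.2 ∧
        q.1 * (q.1 + 1) * (q.2.2.2 * (q.2.2.2 + 1)) =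
          q.2.1 * (q.2.1 + 1) * (q.2.2.1 * (q.2.2.1 + 1)) : Finset _) := by
    ext ⟨a, b, c, d⟩
    simp only [Set.mem_ofPred_eq, Prod.mk.injEq, Finset.coe_filter, Finset.mem_product,
      Finset.mem_Icc, ← mul_assoc]
    constructor
    · rintro ⟨_, _, _, _, ⟨rfl, rfl, rfl, rfl⟩, h1, h2, h3, h4, h5, h6⟩
      have := hR _ _ h3
      exact ⟨by omega, h2, h3, h4, h6⟩
    · rintro ⟨h1, h2, h3, h4, h5⟩
      exact ⟨a, b, c, d, ⟨rfl, rfl, rfl, rfl⟩, by omega, h2, h3, h4, by omega, h5⟩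
  rw [hset, Set.ncard_coe_finset, Finset.card_filter]
  push_cast
  simp only [Finset.sum_product]
  refine Finset.sum_congr rfl fun a _ => ?_
  exact (Finset.sum_congr rfl fun b _ => Finset.sum_comm).trans Finset.sum_comm

theorem numSol_eq_sum (N : ℕ) : (numSol N : ℝ) =
    ∑ a ∈ Finset.Icc 1 N, ∑ d ∈ Finset.Icc 1 N, ∑ b ∈ Finset.Icc 1 N, ∑ c ∈ Finset.Icc 1 N,
      orderedInd (· < ·) a d b c :=
  ncard_eq_sum_orderedInd (· < ·) (fun _ _ => le_of_lt) N

theorem numSolEq_eq_sum (N : ℕ) : (numSolEq N : ℝ) =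
    ∑ a ∈ Finset.Icc 1 N, ∑ d ∈ Finset.Icc 1 N, ∑ b ∈ Finset.Icc 1 N, ∑ c ∈ Finset.Icc 1 N,
      orderedInd (· = ·) a d b c :=
  ncard_eq_sum_orderedInd (· = ·) (fun _ _ => le_of_eq) N

/-- In a solution, the order of `a` and `b` is opposite to the order of `d` and `c`. -/
theorem lt_of_mul_eq_mul_of_lt {a b c d : ℕ} (hd : 0 < d)
    (h : a * (a + 1) * (d * (d + 1)) = b * (b + 1) * (c * (c + 1))) (hab : a < b) : c < d := by
  by_contra! hdc
  have h1 : a * (a + 1) < b * (b + 1) := Nat.mul_lt_mul'' hab (by omega)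
  have h2 : d * (d + 1) ≤ c * (c + 1) := Nat.mul_le_mul hdc (by omega)
  have h3 : 0 < c * (c + 1) := lt_of_lt_of_le (by positivity) h2
  exact absurd h (Nat.mul_lt_mul_of_lt_of_le h1 h2 h3).ne

/-- The indicator of the solutions in which `b` and `c` lie strictly between `a` and `d`. -/
noncomputable def nestedInd (a d b c : ℕ) : ℝ :=
  if a * (a + 1) * (d * (d + 1)) = b * (b + 1) * (c * (c + 1)) ∧
    ((a < b ∧ a < c) ∨ (d < b ∧ d < c)) then 1 else 0

/-- A solution either is trivial, or has `b, c` strictly between `a` and `d`, or has `a, d`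
strictly between `b` and `c`. -/
theorem ite_eq_trivial_add_nestedInd {a d b c : ℕ} (ha : 0 < a) (hd : 0 < d) (hb : 0 < b)
    (hc : 0 < c) :
    (if a * (a + 1) * (d * (d + 1)) = b * (b + 1) * (c * (c + 1)) then (1 : ℝ) else 0) =
      (if a = b ∧ d = c then 1 else 0) + (if a = c ∧ d = b then 1 else 0) -
        (if a = b ∧ d = c ∧ a = d then 1 else 0) + nestedInd a d b c + nestedInd b c a d := by
  unfold nestedInd
  by_cases h : a * (a + 1) * (d * (d + 1)) = b * (b + 1) * (c * (c + 1))
  · have h1 := lt_of_mul_eq_mul_of_lt hd h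
    have h2 := lt_of_mul_eq_mul_of_lt hd (h.trans (mul_comm _ _))
    have h3 := lt_of_mul_eq_mul_of_lt ha ((mul_comm _ _).trans h)
    have h4 := lt_of_mul_eq_mul_of_lt ha ((mul_comm _ _).trans (h.trans (mul_comm _ _)))
    have h5 := lt_of_mul_eq_mul_of_lt hc h.symm
    have h6 := lt_of_mul_eq_mul_of_lt hc (h.symm.trans (mul_comm _ _))
    have h7 := lt_of_mul_eq_mul_of_lt hb ((mul_comm _ _).trans h.symm)
    have h8 := lt_of_mul_eq_mul_of_lt hb ((mul_comm _ _).trans (h.symm.trans (mul_comm _ _)))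
    simp only [h, true_and, if_true]
    split_ifs <;> first | omega | norm_num
  · have t1 : ¬(a = b ∧ d = c) := fun ⟨e1, e2⟩ => h (by rw [e1, e2])
    have t2 : ¬(a = c ∧ d = b) := fun ⟨e1, e2⟩ => h (by rw [e1, e2, mul_comm])
    have t3 : ¬(a = b ∧ d = c ∧ a = d) := fun ⟨e1, e2, _⟩ => t1 ⟨e1, e2⟩
    simp only [h, Ne.symm h, t1, t2, t3, false_and, if_false]
    norm_num

/-- A solution with `b, c` strictly between `a` and `d` becomes one with `a < b ≤ c < d` after
exchanging `a, d` or `b, c` if necessary. -/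
theorem nestedInd_eq_sum_orderedInd {a d b c : ℕ} (ha : 0 < a) (hd : 0 < d) :
    nestedInd a d b c =
      orderedInd (· < ·) a d b c + orderedInd (· < ·) d a b c +
        (orderedInd (· < ·) a d c b + orderedInd (· < ·) d a c b) +
        (orderedInd (· = ·) a d b c + orderedInd (· = ·) d a b c) := by
  unfold nestedInd orderedInd
  rw [mul_comm (d * (d + 1)) (a * (a + 1)), mul_comm (c * (c + 1)) (b * (b + 1))]
  by_cases h : a * (a + 1) * (d * (d + 1)) = b * (b + 1) * (c * (c + 1))
  · have h1 := lt_of_mul_eq_mul_of_lt hd h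
    have h2 := lt_of_mul_eq_mul_of_lt hd (h.trans (mul_comm _ _))
    have h3 := lt_of_mul_eq_mul_of_lt ha ((mul_comm _ _).trans h)
    have h4 := lt_of_mul_eq_mul_of_lt ha ((mul_comm _ _).trans (h.trans (mul_comm _ _)))
    simp only [h, true_and, and_true]
    by_cases k1 : a < b ∧ a < c
    · have : ¬ d < b := by omega
      have : ¬ d < c := by omega
      have : b < d := by omega
      have : c < d := by omega
      simp only [*, true_and, and_true, false_and, and_false, if_false, if_true, or_false]
      split_ifs <;> first | omega | norm_num
    · by_cases k2 : d < b ∧ d < c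
      · have : ¬ a < b := by omega
        have : ¬ a < c := by omega
        have : b < a := by omega
        have : c < a := by omega
        simp only [*, true_and, and_true, false_and, and_false, if_false, if_true, or_true]
        split_ifs <;> first | omega | norm_num
      · rw [if_neg (by omega), if_neg (by omega), if_neg (by omega), if_neg (by omega),
          if_neg (by omega), if_neg (by omega), if_neg (by omega)]
        norm_num
  · simp [h]

theorem sum_nestedInd (N : ℕ) :
    ∑ a ∈ Finset.Icc 1 N, ∑ d ∈ Finset.Icc 1 N, ∑ b ∈ Finset.Icc 1 N, ∑ c ∈ Finset.Icc 1 N,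
      nestedInd a d b c = 4 * numSol N + 2 * numSolEq N := by
  -- the sum over `a, d, b, c` is invariant under exchanging `a, d` and under exchanging `b, c`
  have swap : ∀ F : ℕ → ℕ → ℕ → ℕ → ℝ,
      ∑ a ∈ Finset.Icc 1 N, ∑ d ∈ Finset.Icc 1 N, ∑ b ∈ Finset.Icc 1 N, ∑ c ∈ Finset.Icc 1 N,
        F d a b c =
      ∑ a ∈ Finset.Icc 1 N, ∑ d ∈ Finset.Icc 1 N, ∑ b ∈ Finset.Icc 1 N, ∑ c ∈ Finset.Icc 1 N,
        F a d b c := fun F => Finset.sum_comm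
  have swap' : ∀ F : ℕ → ℕ → ℕ → ℕ → ℝ,
      ∑ a ∈ Finset.Icc 1 N, ∑ d ∈ Finset.Icc 1 N, ∑ b ∈ Finset.Icc 1 N, ∑ c ∈ Finset.Icc 1 N,
        F a d c b =
      ∑ a ∈ Finset.Icc 1 N, ∑ d ∈ Finset.Icc 1 N, ∑ b ∈ Finset.Icc 1 N, ∑ c ∈ Finset.Icc 1 N,
        F a d b c := fun F =>
    Finset.sum_congr rfl fun _ _ => Finset.sum_congr rfl fun _ _ => Finset.sum_comm
  have hcongr := fun a (ha : a ∈ Finset.Icc 1 N) => Finset.sum_congr (s₁ := Finset.Icc 1 N) rfl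
    fun d (hd : d ∈ Finset.Icc 1 N) => Finset.sum_congr (s₁ := Finset.Icc 1 N) rfl
    fun b _ => Finset.sum_congr (s₁ := Finset.Icc 1 N) rfl fun c _ =>
      nestedInd_eq_sum_orderedInd (b := b) (c := c) (Finset.mem_Icc.1 ha).1 (Finset.mem_Icc.1 hd).1
  rw [Finset.sum_congr rfl hcongr, numSol_eq_sum, numSolEq_eq_sum]
  simp only [Finset.sum_add_distrib]
  rw [swap fun a d b c => orderedInd (· < ·) a d b c,
    swap fun a d b c => orderedInd (· < ·) a d c b,
    swap fun a d b c => orderedInd (· = ·) a d b c,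
    swap' fun a d b c => orderedInd (· < ·) a d b c]
  ring

theorem sum_trivial (N : ℕ) :
    ∑ a ∈ Finset.Icc 1 N, ∑ d ∈ Finset.Icc 1 N, ∑ b ∈ Finset.Icc 1 N, ∑ c ∈ Finset.Icc 1 N,
      ((if a = b ∧ d = c then (1 : ℝ) else 0) + (if a = c ∧ d = b then 1 else 0) -
        (if a = b ∧ d = c ∧ a = d then 1 else 0)) = 2 * (N : ℝ) ^ 2 - N := by
  have h1 : ∀ a ∈ Finset.Icc 1 N, ∀ d ∈ Finset.Icc 1 N,
      ∑ b ∈ Finset.Icc 1 N, ∑ c ∈ Finset.Icc 1 N,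
      ((if a = b ∧ d = c then (1 : ℝ) else 0) + (if a = c ∧ d = b then 1 else 0) -
        (if a = b ∧ d = c ∧ a = d then 1 else 0)) = 2 - if a = d then 1 else 0 := by
    intro a ha d hd
    simp only [Finset.sum_add_distrib, Finset.sum_sub_distrib, ite_and, Finset.sum_ite_eq,
      ha, hd, if_true, Finset.sum_ite_irrel, Finset.sum_const_zero]
    norm_num
  rw [Finset.sum_congr rfl fun a ha => Finset.sum_congr rfl fun d hd => h1 a ha d hd]
  have h2 : ∀ a ∈ Finset.Icc 1 N,
      ∑ d ∈ Finset.Icc 1 N, ((2 : ℝ) - if a = d then 1 else 0) = 2 * N - 1 := by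
    intro a ha
    simp only [Finset.sum_sub_distrib, Finset.sum_ite_eq, ha, if_true, Finset.sum_const,
      Nat.card_Icc, nsmul_eq_mul, Nat.add_sub_cancel]
    ring
  rw [Finset.sum_congr rfl h2]
  simp only [Finset.sum_const, Nat.card_Icc, nsmul_eq_mul, Nat.add_sub_cancel]
  ring

/-- The number of solutions of `a(a+1)d(d+1) = b(b+1)c(c+1)` in `[1, N]⁴`. -/
theorem sum_solutions (N : ℕ) :
    ∑ a ∈ Finset.Icc 1 N, ∑ d ∈ Finset.Icc 1 N, ∑ b ∈ Finset.Icc 1 N, ∑ c ∈ Finset.Icc 1 N,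
      (if a * (a + 1) * (d * (d + 1)) = b * (b + 1) * (c * (c + 1)) then (1 : ℝ) else 0) =
      2 * (N : ℝ) ^ 2 - N + 8 * numSol N + 4 * numSolEq N := by
  have hcongr : ∀ a ∈ Finset.Icc 1 N, ∀ d ∈ Finset.Icc 1 N, ∀ b ∈ Finset.Icc 1 N,
      ∀ c ∈ Finset.Icc 1 N, _ := fun a ha d hd b hb c hc =>
    ite_eq_trivial_add_nestedInd (Finset.mem_Icc.1 ha).1 (Finset.mem_Icc.1 hd).1
      (Finset.mem_Icc.1 hb).1 (Finset.mem_Icc.1 hc).1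
  rw [Finset.sum_congr rfl fun a ha => Finset.sum_congr rfl fun d hd =>
    Finset.sum_congr rfl fun b hb => Finset.sum_congr rfl fun c hc => hcongr a ha d hd b hb c hc]
  -- exchange the pair `a, d` with the pair `b, c`
  have hswap : ∑ a ∈ Finset.Icc 1 N, ∑ d ∈ Finset.Icc 1 N, ∑ b ∈ Finset.Icc 1 N,
      ∑ c ∈ Finset.Icc 1 N, nestedInd b c a d = 4 * numSol N + 2 * numSolEq N := by
    rw [← sum_nestedInd]
    have h := Finset.sum_comm (s := Finset.Icc 1 N ×ˢ Finset.Icc 1 N)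
      (t := Finset.Icc 1 N ×ˢ Finset.Icc 1 N) (f := fun p q => nestedInd q.1 q.2 p.1 p.2)
    simpa only [Finset.sum_product] using h
  have htriv := sum_trivial N
  have hnest := sum_nestedInd N
  simp only [Finset.sum_add_distrib] at htriv hnest hswap ⊢
  rw [htriv, hnest, hswap]
  ring

/-! ### The lower bound -/

theorem finite_quadruples {N : ℕ} {S : Set (ℕ × ℕ × ℕ × ℕ)}
    (h : ∀ q ∈ S, q.1 ≤ N ∧ q.2.1 ≤ N ∧ q.2.2.1 ≤ N ∧ q.2.2.2 ≤ N) : S.Finite :=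
  (Set.finite_Iic (N, N, N, N)).subset h

/-- The polynomial identity `f(n) f(6n+2) = f(2n+1) f(3n)` for `f(x) = x(x+1)` gives one solution
for each `n ≥ 2`; the solution `(1, 2, 5, 9)` takes the place of the degenerate case `n = 1`. -/
theorem div_six_le_numSol {N : ℕ} (hN : 9 ≤ N) : (N - 2) / 6 ≤ numSol N := by
  set φ : ℕ → ℕ × ℕ × ℕ × ℕ :=
    fun n => if n = 1 then (1, 2, 5, 9) else (n, 2 * n + 1, 3 * n, 6 * n + 2) with hφ
  have hφ1 : ∀ n, (φ n).1 = n := fun n => by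
    by_cases h : n = 1 <;> simp [hφ, h]
  have hinj : Function.Injective φ := fun m n h => by
    rw [← hφ1 m, ← hφ1 n, h]
  calc (N - 2) / 6 = ((Finset.Icc 1 ((N - 2) / 6)).image φ).card := by
        rw [Finset.card_image_of_injective _ hinj]
        simp
    _ = Set.ncard (((Finset.Icc 1 ((N - 2) / 6)).image φ : Finset _) : Set (ℕ × ℕ × ℕ × ℕ)) :=
        (Set.ncard_coe_finset _).symm
    _ ≤ numSol N := by
        refine Set.ncard_le_ncard ?_ (finite_quadruples (N := N) ?_)
        · intro q hq
          obtain ⟨n, hn, rfl⟩ := Finset.mem_image.1 (Finset.mem_coe.1 hq)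
          rw [Finset.mem_Icc] at hn
          by_cases h : n = 1
          · exact ⟨1, 2, 5, 9, by simp [hφ, h], by omega⟩
          · exact ⟨n, 2 * n + 1, 3 * n, 6 * n + 2, by simp [hφ, h], by omega, by omega, by omega,
              by omega, by omega, by ring⟩
        · rintro _ ⟨a, b, c, d, rfl, h⟩
          dsimp only
          omega

theorem one_le_numSolEq {N : ℕ} (hN : 8 ≤ N) : 1 ≤ numSolEq N := by
  refine Nat.one_le_iff_ne_zero.2 (Set.ncard_ne_zero_of_mem (a := (1, 3, 3, 8))
    ⟨1, 3, 3, 8, rfl, by omega⟩ (finite_quadruples (N := N) ?_))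
  rintro _ ⟨a, b, c, d, rfl, h⟩
  dsimp only
  omega

theorem half_le_numSol_numSolEq {N : ℕ} (hN : 8 ≤ N) :
    (N : ℝ) / 2 ≤ 8 * (numSol N : ℝ) + 4 * (numSolEq N : ℝ) := by
  have h1 := one_le_numSolEq hN
  have h : N ≤ 2 * (8 * numSol N + 4 * numSolEq N) := by
    rcases hN.eq_or_lt with h | h
    · omega
    · have := div_six_le_numSol h
      omega
  have : (N : ℝ) ≤ 2 * (8 * numSol N + 4 * numSolEq N) := by exact_mod_cast h
  linarith

/-! ### The upper bound -/

/-- The defect `h = x_a x_d - x_b x_c` of a quadruple, where `x_a = 2a + 1` and so on. -/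
def defect (a b c d : ℤ) : ℤ := (2 * a + 1) * (2 * d + 1) - (2 * b + 1) * (2 * c + 1)

/-- The smaller of the two factors `(x_d - (h + 1) x_a) ± (x_c - x_b)` of `h (h + 2) (x_a ^ 2 - 1)`
attached to a solution. -/
def smallFactor (a b c d : ℤ) : ℤ :=
  2 * d + 1 - (defect a b c d + 1) * (2 * a + 1) - 2 * (c - b)

section Factorization

variable {a b c d : ℤ}

/-- The equation, rewritten as a difference of two squares
`(x_d - (h + 1) x_a)² - (x_c - x_b)² = h (h + 2) (x_a² - 1)`. -/
theorem smallFactor_mul (h : a * (a + 1) * d * (d + 1) = b * (b + 1) * c * (c + 1)) :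
    smallFactor a b c d * (smallFactor a b c d + 4 * (c - b)) =
      defect a b c d * (defect a b c d + 2) * (4 * a * (a + 1)) := by
  unfold smallFactor defect
  linear_combination (-16) * h

theorem defect_pos (ha : 0 < a) (hab : a < b) (hbc : b ≤ c) (hcd : c < d)
    (h : a * (a + 1) * d * (d + 1) = b * (b + 1) * c * (c + 1)) : 0 < defect a b c d := by
  have hdb : 0 < d * (d + 1) - b * (b + 1) := by nlinarith
  have hdc : 0 < d * (d + 1) - c * (c + 1) := by nlinarith
  have hD : 0 < d * (d + 1) := by nlinarith
  have h1 : 0 < a * (a + 1) + d * (d + 1) - b * (b + 1) - c * (c + 1) := by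
    refine pos_of_mul_pos_right (a := d * (d + 1)) ?_ hD.le
    calc 0 < (d * (d + 1) - b * (b + 1)) * (d * (d + 1) - c * (c + 1)) := mul_pos hdb hdc
      _ = _ := by linear_combination -h
  refine pos_of_mul_pos_left (b := (2 * a + 1) * (2 * d + 1) + (2 * b + 1) * (2 * c + 1)) ?_ ?_
  · calc 0 < 4 * (a * (a + 1) + d * (d + 1) - b * (b + 1) - c * (c + 1)) := by linarith
      _ = _ := by
        unfold defect
        linear_combination (-16) * h
  · have := mul_pos (a := 2 * a + 1) (b := 2 * d + 1) (by omega) (by omega)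
    have := mul_pos (a := 2 * b + 1) (b := 2 * c + 1) (by omega) (by omega)
    linarith

/-- The defect is small: `h x_a < x_d`. -/
theorem defect_mul_lt (ha : 0 < a) (hab : a < b) (hbc : b ≤ c) (hcd : c < d)
    (h : a * (a + 1) * d * (d + 1) = b * (b + 1) * c * (c + 1)) :
    defect a b c d * (2 * a + 1) < 2 * d + 1 := by
  have hpos := defect_pos ha hab hbc hcd h
  have hfac : defect a b c d * ((2 * a + 1) * (2 * d + 1) + (2 * b + 1) * (2 * c + 1)) =
      (2 * a + 1) ^ 2 + (2 * d + 1) ^ 2 - (2 * b + 1) ^ 2 - (2 * c + 1) ^ 2 := by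
    unfold defect
    linear_combination 16 * h
  have hbc' := mul_pos hpos
    (mul_pos (a := 2 * b + 1) (b := 2 * c + 1) (by omega) (by omega))
  refine lt_of_mul_lt_mul_right (a := 2 * d + 1) ?_ (by omega)
  nlinarith

theorem smallFactor_pos (ha : 0 < a) (hab : a < b) (hbc : b ≤ c) (hcd : c < d)
    (h : a * (a + 1) * d * (d + 1) = b * (b + 1) * c * (c + 1)) : 0 < smallFactor a b c d := by
  have hpos := defect_pos ha hab hbc hcd h
  have hlt := defect_mul_lt ha hab hbc hcd h
  have hmul := smallFactor_mul h
  have hM : (2 * a + 1) ^ 2 ≤ defect a b c d * (defect a b c d + 2) * (4 * a * (a + 1)) := by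
    have : 3 ≤ defect a b c d * (defect a b c d + 2) := by nlinarith
    have := mul_le_mul_of_nonneg_right this (by positivity : 0 ≤ 4 * a * (a + 1))
    nlinarith
  -- `D = x_d - (h + 1) x_a` satisfies `D > -x_a` and `D² ≥ x_a²`, so it is positive
  have hD : 0 < smallFactor a b c d + 2 * (c - b) := by
    have h1 : -(2 * a + 1) < smallFactor a b c d + 2 * (c - b) := by
      unfold smallFactor
      linarith
    by_contra! hneg
    nlinarith
  refine pos_of_mul_pos_left (b := smallFactor a b c d + 4 * (c - b)) ?_ (by linarith)
  rw [hmul]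
  positivity

/-- A solution is determined by `a`, its defect and its small factor. -/
theorem eq_of_defect_eq_of_smallFactor_eq {b' c' d' : ℤ}
    (ha : 0 < a) (hab : a < b) (hbc : b ≤ c) (hcd : c < d)
    (h : a * (a + 1) * d * (d + 1) = b * (b + 1) * c * (c + 1))
    (hab' : a < b') (hbc' : b' ≤ c')
    (h' : a * (a + 1) * d' * (d' + 1) = b' * (b' + 1) * c' * (c' + 1))
    (hdef : defect a b c d = defect a b' c' d')
    (hsf : smallFactor a b c d = smallFactor a b' c' d') : b = b' ∧ c = c' ∧ d = d' := by
  have hpos := smallFactor_pos ha hab hbc hcd h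
  have hmul := smallFactor_mul h
  rw [hdef, ← smallFactor_mul h', ← hsf] at hmul
  -- one factor and the product are the same for both solutions, hence so is the other factor
  have hdiff : c - b = c' - b' := by
    have := mul_left_cancel₀ hpos.ne' hmul
    linarith
  have hd : d = d' := by
    have hsf' := hsf
    unfold smallFactor at hsf'
    rw [hdef, hdiff] at hsf'
    linarith
  subst hd
  have hprod : (2 * b + 1) * (2 * c + 1) = (2 * b' + 1) * (2 * c' + 1) := by
    unfold defect at hdef
    linarith
  have hsq : (b + c + 1) ^ 2 = (b' + c' + 1) ^ 2 := by
    linear_combination hprod + (c - b + c' - b') * hdiff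
  have hsum := (pow_left_inj₀ (by omega) (by linarith [hbc']) two_ne_zero).1 hsq
  omega

end Factorization

/-- The solutions counted by `numSol` and `numSolEq` together. -/
def orderedSolutions (N : ℕ) : Set (ℕ × ℕ × ℕ × ℕ) :=
  {q | 0 < q.1 ∧ q.1 < q.2.1 ∧ q.2.1 ≤ q.2.2.1 ∧ q.2.2.1 < q.2.2.2 ∧ q.2.2.2 ≤ N ∧
    q.1 * (q.1 + 1) * q.2.2.2 * (q.2.2.2 + 1) = q.2.1 * (q.2.1 + 1) * q.2.2.1 * (q.2.2.1 + 1)}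

/-- The triples `(a, h, e)` with `1 ≤ a h ≤ N` and `e ∣ h (h + 2) · 4 a (a + 1)`. -/
def factorTriples (N : ℕ) : Finset (ℕ × ℕ × ℕ) :=
  (Finset.Icc 1 N).biUnion fun m => m.divisorsAntidiagonal.biUnion fun p =>
    (p.2 * (p.2 + 2) * (4 * p.1 * (p.1 + 1))).divisors.image fun e => (p.1, p.2, e)

theorem finite_orderedSolutions (N : ℕ) : (orderedSolutions N).Finite := by
  refine finite_quadruples (N := N) ?_
  rintro ⟨a, b, c, d⟩ ⟨h1, h2, h3, h4, h5, -⟩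
  dsimp only at *
  omega

theorem ncard_orderedSolutions_le (N : ℕ) :
    (orderedSolutions N).ncard ≤ (factorTriples N).card := by
  rw [← Set.ncard_coe_finset]
  refine Set.ncard_le_ncard_of_injOn (fun q => (q.1,
    (defect q.1 q.2.1 q.2.2.1 q.2.2.2).toNat, (smallFactor q.1 q.2.1 q.2.2.1 q.2.2.2).toNat))
    ?_ ?_ (Finset.finite_toSet _)
  · rintro ⟨a, b, c, d⟩ ⟨h1, h2, h3, h4, h5, h6⟩
    dsimp only at *
    zify at h1 h2 h3 h4 h6
    have hp := defect_pos h1 h2 h3 h4 h6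
    have hlt := defect_mul_lt h1 h2 h3 h4 h6
    have hs := smallFactor_pos h1 h2 h3 h4 h6
    have hm := smallFactor_mul h6
    obtain ⟨k, hk⟩ := Int.eq_ofNat_of_zero_le hp.le
    obtain ⟨e, he⟩ := Int.eq_ofNat_of_zero_le hs.le
    rw [hk] at hp hlt hm
    rw [he] at hs hm
    rw [hk, he]
    have hak : a * k ≤ N := by
      zify at h5 ⊢
      linarith
    have hp' : 0 < k := by exact_mod_cast hp
    have ha' : 0 < a := by exact_mod_cast h1
    simp only [factorTriples, Finset.coe_biUnion, Set.mem_iUnion, Finset.mem_coe,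
      Nat.mem_divisorsAntidiagonal, Nat.mem_divisors, Finset.mem_Icc, Int.toNat_natCast,
      Finset.coe_image, Set.mem_image, exists_prop]
    refine ⟨a * k, ⟨Nat.mul_pos ha' hp', hak⟩, (a, k), ⟨rfl, by positivity⟩, e,
      ⟨?_, by positivity⟩, rfl⟩
    zify
    exact Dvd.intro _ hm
  · rintro ⟨a, b, c, d⟩ ⟨h1, h2, h3, h4, h5, h6⟩ ⟨a', b', c', d'⟩
      ⟨h1', h2', h3', h4', h5', h6'⟩ heq
    simp only [Prod.mk.injEq] at heq
    dsimp only at *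
    obtain ⟨rfl, e1, e2⟩ := heq
    zify at h1 h2 h3 h4 h6 h2' h3' h4' h6'
    have hp := defect_pos h1 h2 h3 h4 h6
    have hs := smallFactor_pos h1 h2 h3 h4 h6
    have hp' := defect_pos h1 h2' h3' h4' h6'
    have hs' := smallFactor_pos h1 h2' h3' h4' h6'
    have := eq_of_defect_eq_of_smallFactor_eq h1 h2 h3 h4 h6 h2' h3' h6' (by omega) (by omega)
    simp only [Prod.mk.injEq]
    exact ⟨trivial, by exact_mod_cast this⟩

/-- There are `O_ε (N ^ (1 + ε))` triples: the divisor bound with exponent `ε / 3` costs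
`N ^ (ε / 3)` for the number of pairs `(a, h)` with a given product `a h ≤ N`, and `N ^ (2 ε / 3)`
for the number of divisors of `h (h + 2) · 4 a (a + 1) ≤ 24 N ^ 2`. -/
theorem card_factorTriples_le {ε : ℝ} (hε : 0 < ε) :
    ∃ C : ℝ, 0 < C ∧ ∀ N : ℕ, 1 ≤ N → ((factorTriples N).card : ℝ) ≤ C * (N : ℝ) ^ (1 + ε) := by
  obtain ⟨K, hK, hdiv⟩ := card_divisors_le_rpow (show 0 < ε / 3 by positivity)
  refine ⟨K * (K * 24 ^ (ε / 3)), by positivity, fun N hN => ?_⟩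
  have hN0 : (0 : ℝ) < N := by exact_mod_cast hN
  have hinner : ∀ m ∈ Finset.Icc 1 N, ∀ p ∈ m.divisorsAntidiagonal,
      ((p.2 * (p.2 + 2) * (4 * p.1 * (p.1 + 1))).divisors.card : ℝ) ≤
        K * (24 * (N : ℝ) ^ 2) ^ (ε / 3) := by
    rintro m hm ⟨a, h⟩ hp
    rw [Finset.mem_Icc] at hm
    rw [Nat.mem_divisorsAntidiagonal] at hp
    obtain ⟨rfl, hne⟩ := hp
    dsimp only
    have ha : 1 ≤ a := Nat.pos_of_ne_zero (left_ne_zero_of_mul hne)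
    have hh : 1 ≤ h := Nat.pos_of_ne_zero (right_ne_zero_of_mul hne)
    have hle : h * (h + 2) * (4 * a * (a + 1)) ≤ 24 * N ^ 2 := by
      calc h * (h + 2) * (4 * a * (a + 1)) ≤ h * (3 * h) * (4 * a * (2 * a)) := by
            gcongr <;> omega
        _ = 24 * (a * h) ^ 2 := by ring
        _ ≤ 24 * N ^ 2 := by
            gcongr
            exact hm.2
    refine (hdiv _ (by positivity)).trans ?_
    gcongr
    exact_mod_cast hle
  have hcard : ((factorTriples N).card : ℝ) ≤
      ∑ m ∈ Finset.Icc 1 N, ∑ p ∈ m.divisorsAntidiagonal,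
        ((p.2 * (p.2 + 2) * (4 * p.1 * (p.1 + 1))).divisors.card : ℝ) := by
    have : (factorTriples N).card ≤ ∑ m ∈ Finset.Icc 1 N, ∑ p ∈ m.divisorsAntidiagonal,
        (p.2 * (p.2 + 2) * (4 * p.1 * (p.1 + 1))).divisors.card :=
      Finset.card_biUnion_le.trans <| Finset.sum_le_sum fun m _ =>
        Finset.card_biUnion_le.trans <| Finset.sum_le_sum fun p _ => Finset.card_image_le
    exact_mod_cast this
  calc ((factorTriples N).card : ℝ)
      ≤ ∑ m ∈ Finset.Icc 1 N, ∑ p ∈ m.divisorsAntidiagonal, K * (24 * (N : ℝ) ^ 2) ^ (ε / 3) :=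
        hcard.trans <| Finset.sum_le_sum fun m hm => Finset.sum_le_sum fun p hp => hinner m hm p hp
    _ ≤ ∑ m ∈ Finset.Icc 1 N, K * (N : ℝ) ^ (ε / 3) * (K * (24 * (N : ℝ) ^ 2) ^ (ε / 3)) := by
        refine Finset.sum_le_sum fun m hm => ?_
        rw [Finset.mem_Icc] at hm
        rw [Finset.sum_const, nsmul_eq_mul, ← Nat.map_div_right_divisors, Finset.card_map]
        have hmN : (m : ℝ) ≤ N := by exact_mod_cast hm.2
        have := hdiv m (by omega)
        gcongr
        refine this.trans ?_
        gcongr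
    _ = K * (K * 24 ^ (ε / 3)) * (N : ℝ) ^ (1 + ε) := by
        rw [Finset.sum_const, Nat.card_Icc, Nat.add_sub_cancel, nsmul_eq_mul,
          Real.mul_rpow (by norm_num) (by positivity), ← Real.rpow_natCast, ← Real.rpow_mul hN0.le,
          show 1 + ε = 1 + (ε / 3 + ((2 : ℕ) : ℝ) * (ε / 3)) by push_cast; ring,
          Real.rpow_add hN0, Real.rpow_add hN0, Real.rpow_one]
        ring

theorem numSol_numSolEq_le {ε : ℝ} (hε : 0 < ε) :
    ∃ C : ℝ, 0 < C ∧ ∀ N : ℕ, 1 ≤ N →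
      8 * (numSol N : ℝ) + 4 * (numSolEq N : ℝ) ≤ C * (N : ℝ) ^ (1 + ε) := by
  obtain ⟨C, hC, h⟩ := card_factorTriples_le hε
  refine ⟨12 * C, by positivity, fun N hN => ?_⟩
  have h1 : numSol N ≤ (orderedSolutions N).ncard := by
    refine Set.ncard_le_ncard ?_ (finite_orderedSolutions N)
    rintro _ ⟨a, b, c, d, rfl, k1, k2, k3, k4, k5, k6⟩
    exact ⟨k1, k2, k3.le, k4, k5, k6⟩
  have h2 : numSolEq N ≤ (orderedSolutions N).ncard := by
    refine Set.ncard_le_ncard ?_ (finite_orderedSolutions N)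
    rintro _ ⟨a, b, c, d, rfl, k1, k2, k3, k4, k5, k6⟩
    exact ⟨k1, k2, k3.le, k4, k5, k6⟩
  have h3 := ncard_orderedSolutions_le N
  have h4 : (numSol N : ℝ) ≤ (factorTriples N).card := by exact_mod_cast h1.trans h3
  have h5 : (numSolEq N : ℝ) ≤ (factorTriples N).card := by exact_mod_cast h2.trans h3
  linarith [h N hN]

/-! ### Asymptotics of the fourth moment -/

theorem mainTheorem10 :
    (∀ (Ω : Type u) [MeasurableSpace Ω] (P : Measure Ω) [IsProbabilityMeasure P]
        (Y : Nat.Primes → Ω → ℂ), IsIIDUniformOnCircle P Y → ∀ N : ℕ, 1 ≤ N →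
      fourthMoment P Y N =
        2 * (N : ℝ) ^ 2 - (N : ℝ) + 8 * (numSol N : ℝ) + 4 * (numSolEq N : ℝ)) ∧
    (∀ ε : ℝ, 0 < ε → ∃ C : ℝ, 0 < C ∧ ∀ N : ℕ, 8 ≤ N →
      (N : ℝ) / 2 ≤ 8 * (numSol N : ℝ) + 4 * (numSolEq N : ℝ) ∧
      8 * (numSol N : ℝ) + 4 * (numSolEq N : ℝ) ≤ C * (N : ℝ) ^ (3 / 2 + ε)) ∧
    (∀ ε : ℝ, 0 < ε → ∃ C : ℝ, 0 < C ∧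
      ∀ (Ω : Type u) [MeasurableSpace Ω] (P : Measure Ω) [IsProbabilityMeasure P]
        (Y : Nat.Primes → Ω → ℂ), IsIIDUniformOnCircle P Y → ∀ N : ℕ, 1 ≤ N →
      |fourthMoment P Y N - 2 * (N : ℝ) ^ 2| ≤ C * (N : ℝ) ^ (3 / 2 + ε)) := by
  have hup : ∀ ε : ℝ, 0 < ε → ∃ C : ℝ, 0 < C ∧ ∀ N : ℕ, 1 ≤ N →
      8 * (numSol N : ℝ) + 4 * (numSolEq N : ℝ) ≤ C * (N : ℝ) ^ (3 / 2 + ε) := by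
    intro ε hε
    obtain ⟨C, hC, h⟩ := numSol_numSolEq_le hε
    refine ⟨C, hC, fun N hN => (h N hN).trans ?_⟩
    have : (1 : ℝ) ≤ N := by exact_mod_cast hN
    gcongr
    norm_num
  have hmom : ∀ (Ω : Type u) [MeasurableSpace Ω] (P : Measure Ω) [IsProbabilityMeasure P]
      (Y : Nat.Primes → Ω → ℂ), IsIIDUniformOnCircle P Y → ∀ N : ℕ,
      fourthMoment P Y N =
        2 * (N : ℝ) ^ 2 - (N : ℝ) + 8 * (numSol N : ℝ) + 4 * (numSolEq N : ℝ) :=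
    fun Ω _ P _ Y hY N => (hY.fourthMoment_eq_sum N).trans (sum_solutions N)
  refine ⟨fun Ω _ P _ Y hY N _ => hmom Ω P Y hY N, fun ε hε => ?_, fun ε hε => ?_⟩
  · obtain ⟨C, hC, h⟩ := hup ε hε
    exact ⟨C, hC, fun N hN => ⟨half_le_numSol_numSolEq hN, h N (by omega)⟩⟩
  · obtain ⟨C, hC, h⟩ := hup ε hε
    refine ⟨C + 1, by positivity, fun Ω _ P _ Y hY N hN => ?_⟩
    have hN1 : (1 : ℝ) ≤ N := by exact_mod_cast hN
    have hpow : (N : ℝ) ≤ (N : ℝ) ^ (3 / 2 + ε) :=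
      Real.self_le_rpow_of_one_le hN1 (by linarith)
    have hle := h N hN
    have h0 : 0 ≤ 8 * (numSol N : ℝ) + 4 * (numSolEq N : ℝ) := by positivity
    have h1 : 0 ≤ C * (N : ℝ) ^ (3 / 2 + ε) := by positivity
    rw [hmom Ω P Y hY N, abs_le]
    constructor <;> linarith
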